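/- **Theorem (orthogonal arrays and second-order Trotter approximation).** There is an absolute constant $C>0$ such that the following holds. Let $d\ge 1$ and $n,k\ge 0$ be integers, and let $M=(m_{ji})$ be an orthogonal array $OA(N,n,d^2,k)$, that is, an $N\times n$ array ($N\ge 1$) with entries from an alphabet of $d^2$ letters such that every $N\times k$ subarray contains each $k$-tuple of letters as a row exactly $N/d^{2k}$ times. Let $X=\sum_{x}|x+1 \bmod d\rangle\langle x|$ and $Z=\mathrm{diag}(\omega^0,\dots,\omega^{d-1})$ with $\omega=e^{2\pi i/d}$, let $P_1,\dots,P_{d^2}$ be the generalized Pauli matrices $X^aZ^b$ ($0\le a,b<d$) in any order, and put $U_j=P_{m_{j1}}\otimes\cdots\otimes P_{m_{jn}}$ for $1\le j\le N$. For an operator $V$ on $(\mathbb{C}^d)^{\otimes n}$ write $\Lambda(V)=|0\rangle\langle 0|\otimes V+|1\rangle\langle 1|\otimes I$ and $\mathrm{ctrl}(V)=|0\rangle\langle 0|\otimes I+|1\rangle\langle 1|\otimes V$. A *controlled generalized Pauli* is an operator $\Lambda(Q_1\otimes\cdots\otimes Q_n)$ with every $Q_i$ of the form $\omega^cX^aZ^b$.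 Let $t\ge 0$, $h\ge 0$ and $\varepsilon>0$. Then there are an integer $r\ge 1$ and a circuit, composed only of controlled generalized Paulis and of calls $I_2\otimes e^{-iH\tau}$ (with times $\tau\ge 0$ of our choice) to the black-box evolution under a Hamiltonian $H$, that contains at most $$C\,N\,\max\left\{1,\ \frac{t^{3/2}h^{3/2}}{\varepsilon^{1/2}}\right\}$$ controlled generalized Paulis and has the following property. For every $k$-local Hamiltonian $H$ on $(\mathbb{C}^d)^{\otimes n}$ (a sum, over all $k$-tuples $i_1<\dots<i_k$ of qudits, of traceless Hermitian operators acting only on the qudits $i_1,\dots,i_k$) with spectral norm $\|H\|\le h$, the operator $\tilde U$ realized by the circuit is unitary, is equal to the symmetric second-order Trotter–Suzuki formula $$\tilde U=\Big(e^{-iK_1\frac{t}{2r}}\cdots e^{-iK_N\frac{t}{2r}}\cdot e^{-iK_N\frac{t}{2r}}\cdots e^{-iK_1\frac{t}{2r}}\Big)^r,\qquad K_j=\tfrac1N\,\Lambda(U_j)\,(I_2\otimes H)\,\Lambda(U_j)^\dagger,$$ and satisfies, in spectral norm, $$\big\|\tilde U-\mathrm{ctrl}(e^{-iHt})\big\|\le\varepsilon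 .$$ In particular, with $h=\|H\|$, the unitary $\mathrm{ctrl}(e^{-iHt})$ is realized to error $\varepsilon$ with $O\big(N\,t^{3/2}\|H\|^{3/2}/\varepsilon^{1/2}\big)$ controlled generalized Paulis whenever $t^3\|H\|^3\ge\varepsilon$. -/

import Mathlib

open scoped Matrix Kronecker NNReal Matrix.Norms.L2Operator

noncomputable section

namespace Controlization

/-- Operators on the `n`-qudit space `(ℂ^d)^{⊗ n}`, as matrices in the computational basis, whose
vectors `|x₁ … xₙ⟩` are labelled by the functions `x : Fin n → ZMod d`. -/
abbrev QuditOp (d n : ℕ) : Type := Matrix (Fin n → ZMod d) (Fin n → ZMod d) ℂ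

/-- Operators on `ℂ² ⊗ (ℂ^d)^{⊗ n}`, a control qubit together with `n` qudits. -/
abbrev CtrlOp (d n : ℕ) : Type :=
  Matrix (Fin 2 × (Fin n → ZMod d)) (Fin 2 × (Fin n → ZMod d)) ℂ

/-! ### Orthogonal arrays -/

/-- The `N × n` array `M` with entries in an alphabet with `s` letters is an `OA(N, n, s, t)`:
it is nonempty and, in every `N × t` subarray (given by an increasing choice `c` of `t` columns),
every `t`-tuple `w` of letters is a row exactly `N / s ^ t` times. -/
def IsOrthogonalArray {N n s : ℕ} (M : Matrix (Fin N) (Fin n) (Fin s)) (t : ℕ) : Prop :=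
  0 < N ∧ ∀ (c : Fin t ↪o Fin n) (w : Fin t → Fin s),
    (Finset.univ.filter fun j : Fin N => ∀ i, M j (c i) = w i).card * s ^ t = N

/-! ### Local Hamiltonians -/

/-- The operator `A` on `k` qudits, acting on the qudits `c 0 < c 1 < … < c (k-1)` of an
`n`-qudit system, and as the identity on the other qudits. -/
def actOn {d n k : ℕ} (c : Fin k ↪o Fin n) (A : QuditOp d k) : QuditOp d n :=
  open Classical in
  Matrix.of fun x y =>
    if ∀ i, i ∉ Set.range c → x i = y i then A (fun l => x (c l)) (fun l => y (c l)) else 0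

/-- `H` is a `k`-local Hamiltonian: a sum, over all increasing `k`-tuples of qudits, of traceless
Hermitian operators acting only on these `k` qudits. -/
def IsLocalHamiltonian {d n : ℕ} [NeZero d] (k : ℕ) (H : QuditOp d n) : Prop :=
  ∃ h : (Fin k ↪o Fin n) → QuditOp d k,
    (∀ c, (h c).IsHermitian ∧ (h c).trace = 0) ∧ H = ∑ c, actOn c (h c)

/-! ### Generalized Pauli operators -/

/-- The shift `X = ∑ x, |x + 1 mod d⟩⟨x|`. -/
def shiftX (d : ℕ) : Matrix (ZMod d) (ZMod d) ℂ :=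
  Matrix.of fun x y => if x = y + 1 then 1 else 0

/-- The root of unity `ω = exp (2 π i / d)`. -/
def omega (d : ℕ) : ℂ := Complex.exp (2 * Real.pi * Complex.I / d)

/-- The clock `Z = diag (ω^0, …, ω^(d-1))`. -/
def clockZ (d : ℕ) : Matrix (ZMod d) (ZMod d) ℂ :=
  Matrix.diagonal fun x => omega d ^ x.val

/-- The generalized Pauli matrix `X^a Z^b`. -/
def pauli {d : ℕ} [NeZero d] (ab : ZMod d × ZMod d) : Matrix (ZMod d) (ZMod d) ℂ :=
  shiftX d ^ ab.1.val * clockZ d ^ ab.2.val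

/-- The tensor product `A₁ ⊗ … ⊗ Aₙ`. -/
def tensor {d n : ℕ} (A : Fin n → Matrix (ZMod d) (ZMod d) ℂ) : QuditOp d n :=
  Matrix.of fun x y => ∏ i, A i (x i) (y i)

/-- The label `(c, a, b)` of the element `ω^c X^a Z^b` of the finite group generated by
`X` and `Z`. -/
structure PauliLabel (d : ℕ) where
  c : ZMod d
  a : ZMod d
  b : ZMod d

/-- The element `ω^c X^a Z^b`. -/
def PauliLabel.toMatrix {d : ℕ} [NeZero d] (p : PauliLabel d) : Matrix (ZMod d) (ZMod d) ℂ :=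
  omega d ^ p.c.val • pauli (p.a, p.b)

/-! ### Controlled operators and circuits -/

/-- `Λ(V) = |0⟩⟨0| ⊗ V + |1⟩⟨1| ⊗ I`. -/
def Lam {d n : ℕ} (V : QuditOp d n) : CtrlOp d n :=
  Matrix.single (0 : Fin 2) (0 : Fin 2) (1 : ℂ) ⊗ₖ V +
    Matrix.single (1 : Fin 2) (1 : Fin 2) (1 : ℂ) ⊗ₖ (1 : QuditOp d n)

/-- `ctrl(U) = |0⟩⟨0| ⊗ I + |1⟩⟨1| ⊗ U`. -/
def ctrl {d n : ℕ} (U : QuditOp d n) : CtrlOp d n :=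
  Matrix.single (0 : Fin 2) (0 : Fin 2) (1 : ℂ) ⊗ₖ (1 : QuditOp d n) +
    Matrix.single (1 : Fin 2) (1 : Fin 2) (1 : ℂ) ⊗ₖ U

/-- The time evolution `exp (-i K t)`. -/
def evolution {ι : Type*} [Fintype ι] [DecidableEq ι] (K : Matrix ι ι ℂ) (t : ℝ) : Matrix ι ι ℂ :=
  NormedSpace.exp ((-Complex.I * (t : ℂ)) • K)

/-- The gates of a controlization circuit: a controlled tensor product `Λ(Q₁ ⊗ … ⊗ Qₙ)` of
generalized Paulis, or a call of the black box, for a time `τ ≥ 0` of our choice. -/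
inductive Gate (d n : ℕ) : Type
  | ctrlPauli (Q : Fin n → PauliLabel d) : Gate d n
  | blackBox (τ : ℝ≥0) : Gate d n

/-- The operator of a gate when the black box is the time evolution under `H`; the black box
acts on the qudits only, as `I₂ ⊗ exp (-i H τ)`. -/
def Gate.toOp {d n : ℕ} [NeZero d] (H : QuditOp d n) : Gate d n → CtrlOp d n
  | .ctrlPauli Q => Lam (tensor fun i => (Q i).toMatrix)
  | .blackBox τ => (1 : Matrix (Fin 2) (Fin 2) ℂ) ⊗ₖ evolution H τ

/-- A circuit is a list of gates, the first one being applied first. It does not involve `H`. -/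
abbrev Circuit (d n : ℕ) : Type := List (Gate d n)

/-- The operator realized by a circuit when the black box is the time evolution under `H`. -/
def Circuit.toOp {d n : ℕ} [NeZero d] (H : QuditOp d n) : Circuit d n → CtrlOp d n
  | [] => 1
  | g :: c => Circuit.toOp H c * g.toOp H

/-- The number of controlled generalized Paulis in a circuit. -/
def Circuit.numCtrlPaulis {d n : ℕ} : Circuit d n → ℕ
  | [] => 0
  | .ctrlPauli _ :: c => Circuit.numCtrlPaulis c + 1
  | .blackBox _ :: c => Circuit.numCtrlPaulis c

/-! ### The scheme of an orthogonal array, and the second-order product formula -/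

/-- The control operation `U_j = P_{m_{j1}} ⊗ … ⊗ P_{m_{jn}}` of the `j`-th row of the array `M`,
where `P` lists the `d²` generalized Paulis `X^a Z^b`. -/
def rowOp {d n N : ℕ} [NeZero d] (P : Fin (d ^ 2) ≃ ZMod d × ZMod d)
    (M : Matrix (Fin N) (Fin n) (Fin (d ^ 2))) (j : Fin N) : QuditOp d n :=
  tensor fun i => pauli (P (M j i))

/-- The terms `(1/N) Λ(U_j) (I₂ ⊗ H) Λ(U_j)†` of the controlization scheme of the array `M`. -/
def schemeTerm {d n N : ℕ} [NeZero d] (P : Fin (d ^ 2) ≃ ZMod d × ZMod d)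
    (M : Matrix (Fin N) (Fin n) (Fin (d ^ 2))) (H : QuditOp d n) (j : Fin N) : CtrlOp d n :=
  (1 / (N : ℂ)) •
    (Lam (rowOp P M j) * ((1 : Matrix (Fin 2) (Fin 2) ℂ) ⊗ₖ H) * (Lam (rowOp P M j))ᴴ)

/-- The symmetric second-order Trotter–Suzuki formula with `r` steps for `K₁ + … + K_N`,
`(e^{-i K₁ t/2r} ⋯ e^{-i K_N t/2r} · e^{-i K_N t/2r} ⋯ e^{-i K₁ t/2r})^r`. -/
def trotter2 {ι : Type*} [Fintype ι] [DecidableEq ι] {N : ℕ} (K : Fin N → Matrix ι ι ℂ)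
    (t : ℝ) (r : ℕ) : Matrix ι ι ℂ :=
  ((List.ofFn fun j => evolution (K j) (t / (2 * r))).prod *
    (List.ofFn fun j => evolution (K j) (t / (2 * r))).reverse.prod) ^ r

end Controlization

end

/-!
The terms of the scheme are block diagonal in the control qubit: the block of `|1⟩` of the `j`-th
term is `H / N`, the block of `|0⟩` is `U_j H U_j† / N`. Averaging over the generalized Paulis is
completely depolarizing (`sum_pauli_mul_star`), hence annihilates traceless operators
(`sum_pauli_conj_eq_zero`); the rows of an orthogonal array of strength `k` do the same on any `k`
qudits, so that `∑ j, U_j H U_j† = 0` for a `k`-local `H` (`sum_rowOp_conj_eq_zero`). The terms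
therefore add up to `|1⟩⟨1| ⊗ H`, which generates `ctrl (exp (-i H t))`
(`evolution_sum_schemeTerm`).

The evolution under one term is the black box conjugated by `Λ(U_j)`, and `U_j†` is again a product
of generalized Paulis, up to powers of `ω`. So a Trotter step is a circuit with `4 N` controlled
Paulis (`toOp_trotterCircuit`, `numCtrlPaulis_trotterCircuit`).

For the error, the second-order expansions of products of exponentials are tracked together with a
majorant `exp a` of all the power series involved (`HasJet`). For a palindromic product, the terms
of order at most two are those of the exponential of the sum, so that a step with
`x = t h / r ≤ 1` has an error of at most `2 x³` (`norm_palindrome_sub_exp_le`). No commutator is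
needed, and the bound does not depend on the number of terms, as only the sum of their norms
enters. For `x ≥ 1` the same bound is trivial for unitaries. The errors of the `r` steps add up to
`2 (t h)³ / r²` (`norm_trotter2_sub_evolution_le`), which is at most `ε` for some
`r = O(1 + (t h)^(3/2) / ε^(1/2))`.
-/

namespace Controlization

/-! ### Second-order Taylor expansions in a Banach algebra -/

section Jet

variable {A : Type*} [NormedRing A]

/-- `u` has the second-order expansion `1 + p + q`, whose terms of order one and two, and whose
remainder, are majorized by the corresponding parts of the power series of `exp a`. -/
structure HasJet (u p q : A) (a : ℝ) : Prop where
  norm_fst_le : ‖p‖ ≤ a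
  norm_snd_le : ‖q‖ ≤ a ^ 2 / 2
  norm_sub_le : ‖u - (1 + p + q)‖ ≤ Real.exp a - (1 + a + a ^ 2 / 2)

lemma HasJet.nonneg {u p q : A} {a : ℝ} (h : HasJet u p q a) : 0 ≤ a :=
  (norm_nonneg _).trans h.norm_fst_le

/-- The majorants multiply: the remainder of the product is controlled by
`exp a * exp b = exp (a + b)` minus the terms of degree at most two. -/
lemma HasJet.mul [NormOneClass A] {u v p q p' q' : A} {a b : ℝ} (hu : HasJet u p q a)
    (hv : HasJet v p' q' b) : HasJet (u * v) (p + p') (q + p * p' + q') (a + b) := by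
  have ha := hu.nonneg
  have hb := hv.nonneg
  obtain ⟨hp, hq, hR⟩ := hu
  obtain ⟨hp', hq', hR'⟩ := hv
  have hT {x y : A} {c : ℝ} (hx : ‖x‖ ≤ c) (hy : ‖y‖ ≤ c ^ 2 / 2) :
      ‖1 + x + y‖ ≤ 1 + c + c ^ 2 / 2 := by
    refine (norm_add_le _ _).trans (add_le_add ((norm_add_le _ _).trans ?_) hy)
    rw [norm_one]
    linarith
  have hm {x y : A} {c e : ℝ} (hx : ‖x‖ ≤ c) (hy : ‖y‖ ≤ e) : ‖x * y‖ ≤ c * e :=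
    (norm_mul_le _ _).trans
      (mul_le_mul hx hy (norm_nonneg _) ((norm_nonneg _).trans hx))
  refine ⟨(norm_add_le _ _).trans (add_le_add hp hp'), ?_, ?_⟩
  · have h1 : ‖q + p * p' + q'‖ ≤ a ^ 2 / 2 + a * b + b ^ 2 / 2 :=
      (norm_add_le _ _).trans (add_le_add ((norm_add_le _ _).trans (add_le_add hq (hm hp hp'))) hq')
    linarith
  · have hv' : ‖v‖ ≤ Real.exp b := by
      have : v = (v - (1 + p' + q')) + (1 + p' + q') := by abel
      rw [this]
      refine (norm_add_le _ _).trans ?_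
      linarith [hT hp' hq']
    have key : u * v - (1 + (p + p') + (q + p * p' + q')) =
        (u - (1 + p + q)) * v + (1 + p + q) * (v - (1 + p' + q')) +
          (p * q' + q * p' + q * q') := by
      noncomm_ring
    rw [key]
    have h1 := hm hR hv'
    have h2 := hm (hT hp hq) hR'
    have h3 : ‖p * q' + q * p' + q * q'‖ ≤
        a * (b ^ 2 / 2) + a ^ 2 / 2 * b + a ^ 2 / 2 * (b ^ 2 / 2) :=
      (norm_add_le _ _).trans
        (add_le_add ((norm_add_le _ _).trans (add_le_add (hm hp hq') (hm hq hp'))) (hm hq hq'))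
    refine (norm_add_le _ _).trans ((add_le_add ((norm_add_le _ _).trans
      (add_le_add h1 h2)) h3).trans (le_of_eq ?_))
    rw [Real.exp_add]
    ring

lemma hasJet_one : HasJet (1 : A) 0 0 0 := ⟨by simp, by simp, by simp⟩

lemma hasJet_exp [NormedAlgebra ℂ A] [NormOneClass A] [CompleteSpace A] {x : A} {a : ℝ} (hx : ‖x‖ ≤ a) :
    HasJet (NormedSpace.exp x) x ((2 : ℂ)⁻¹ • x ^ 2) a := by
  have ha : 0 ≤ a := (norm_nonneg _).trans hx
  have hn (m : ℕ) : ‖((m.factorial : ℂ)⁻¹) • x ^ m‖ ≤ a ^ m / m.factorial := by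
    rw [norm_smul, norm_inv, Complex.norm_natCast, div_eq_inv_mul]
    gcongr
    exact (norm_pow_le _ _).trans (by gcongr)
  refine ⟨hx, ?_, ?_⟩
  · simpa [Nat.factorial] using hn 2
  · have h1 := NormedSpace.expSeries_hasSum_exp_of_mem_ball' (𝕂 := ℂ) x
      ((NormedSpace.expSeries_radius_eq_top ℂ A).symm ▸ edist_lt_top _ _)
    have h2 : HasSum (fun m : ℕ => a ^ m / m.factorial) (Real.exp a) := by
      rw [Real.exp_eq_exp_ℝ]
      exact NormedSpace.expSeries_div_hasSum_exp a
    have h1' := (hasSum_nat_add_iff' 3).2 h1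
    have h2' := (hasSum_nat_add_iff' 3).2 h2
    have h := h1'.norm_le_of_bounded h2' fun m => hn (m + 3)
    simpa [Finset.sum_range_succ, Nat.factorial] using h

/-- The reversed product has the same first-order term, and the second-order terms of the two
products add up to the square of the first-order term. -/
lemma exists_hasJet_prod_exp [NormedAlgebra ℂ A] [NormOneClass A] [CompleteSpace A] (L : List A) :
    ∃ q q' : A, HasJet (L.map NormedSpace.exp).prod L.sum q (L.map norm).sum ∧
      HasJet (L.map NormedSpace.exp).reverse.prod L.sum q' (L.map norm).sum ∧
      q + q' = L.sum ^ 2 := by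
  induction L with
  | nil => exact ⟨0, 0, by simpa using hasJet_one, by simpa using hasJet_one, by simp⟩
  | cons x L ih =>
    obtain ⟨q, q', h, h', hq⟩ := ih
    have hx := hasJet_exp (le_refl ‖x‖)
    refine ⟨_, q' + L.sum * x + (2 : ℂ)⁻¹ • x ^ 2, by simpa using hx.mul h, ?_, ?_⟩
    · have := h'.mul hx
      rw [add_comm L.sum, add_comm _ ‖x‖] at this
      simpa using this
    · have h2 : x ^ 2 = (2 : ℂ)⁻¹ • x ^ 2 + (2 : ℂ)⁻¹ • x ^ 2 := by
        rw [← add_smul]; norm_num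
      rw [List.sum_cons]
      calc _ = ((2 : ℂ)⁻¹ • x ^ 2 + (2 : ℂ)⁻¹ • x ^ 2) + (q + q') + x * L.sum + L.sum * x := by abel
        _ = x ^ 2 + L.sum ^ 2 + x * L.sum + L.sum * x := by rw [← h2, hq]
        _ = _ := by noncomm_ring

/-- One step of the second-order product formula agrees with the exponential of the sum up to
order two, because it is palindromic. -/
lemma norm_palindrome_sub_exp_le [NormedAlgebra ℂ A] [NormOneClass A] [CompleteSpace A] (L : List A) {x : ℝ}
    (hx : 2 * (L.map norm).sum ≤ x) (hx1 : x ≤ 1) :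
    ‖(L.map NormedSpace.exp).prod * (L.map NormedSpace.exp).reverse.prod -
      NormedSpace.exp ((2 : ℂ) • L.sum)‖ ≤ 2 * x ^ 3 := by
  obtain ⟨q, q', h, h', hq⟩ := exists_hasJet_prod_exp L
  set y := 2 * (L.map norm).sum with hy
  have hS := h.mul h'
  have hn : ‖(2 : ℂ) • L.sum‖ ≤ y := by
    rw [norm_smul, hy]
    simpa using h.norm_fst_le
  have hE := hasJet_exp hn
  have hy0 : 0 ≤ y := hE.nonneg
  have e1 : (2 : ℂ) • L.sum = L.sum + L.sum := two_smul ℂ _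
  have e2 : (2 : ℂ)⁻¹ • ((2 : ℂ) • L.sum) ^ 2 = q + L.sum * L.sum + q' := by
    rw [smul_pow, smul_smul, add_right_comm, hq, ← sq, ← two_smul ℂ]
    norm_num
  have h1 := hS.norm_sub_le
  have h2 := hE.norm_sub_le
  rw [e2, e1] at h2
  rw [← two_mul (List.map norm L).sum, ← hy] at h1
  rw [e1]
  have hexp : Real.exp y - (1 + y + y ^ 2 / 2) ≤ y ^ 3 := by
    have := Real.exp_bound (x := y) (n := 3) (by rw [abs_of_nonneg hy0]; linarith) (by norm_num)
    rw [abs_of_nonneg hy0] at this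
    have := (le_abs_self _).trans this
    norm_num [Finset.sum_range_succ, Nat.factorial] at this
    nlinarith [pow_nonneg hy0 3]
  have hyx : y ^ 3 ≤ x ^ 3 := by gcongr
  calc _ ≤ _ := norm_sub_le_norm_sub_add_norm_sub _ _ _
    _ ≤ _ := add_le_add h1 ((norm_sub_rev _ _).trans_le h2)
    _ ≤ _ := by linarith

lemma norm_pow_sub_pow_le {u v : A} [NormOneClass A] (hu : ‖u‖ ≤ 1) (hv : ‖v‖ ≤ 1) (r : ℕ) :
    ‖u ^ r - v ^ r‖ ≤ r * ‖u - v‖ := by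
  induction r with
  | zero => simp
  | succ r ih =>
    have key : u ^ (r + 1) - v ^ (r + 1) = u ^ r * (u - v) + (u ^ r - v ^ r) * v := by
      rw [pow_succ, pow_succ]; noncomm_ring
    have hur : ‖u ^ r‖ ≤ 1 := (norm_pow_le _ _).trans (pow_le_one₀ (norm_nonneg _) hu)
    rw [key]
    push_cast
    refine (norm_add_le _ _).trans ?_
    have h1 : ‖u ^ r * (u - v)‖ ≤ 1 * ‖u - v‖ := (norm_mul_le _ _).trans (by gcongr)
    have h2 : ‖(u ^ r - v ^ r) * v‖ ≤ (r * ‖u - v‖) * 1 :=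
      (norm_mul_le _ _).trans (by gcongr)
    linarith

end Jet

/-! ### Generalized Pauli matrices -/

section Pauli

variable {d : ℕ} [NeZero d]

lemma omega_pow_val (x : ZMod d) : omega d ^ x.val = ZMod.stdAddChar x := by
  rw [ZMod.stdAddChar_apply, ZMod.toCircle_apply, omega, ← Complex.exp_nat_mul]
  congr 1
  ring

lemma shiftX_pow_apply (m : ℕ) (x y : ZMod d) :
    (shiftX d ^ m) x y = if x = y + m then 1 else 0 := by
  induction m generalizing y with
  | zero => simp [Matrix.one_apply]
  | succ m ih =>
    have h (u : ZMod d) : shiftX d u y = if u = y + 1 then 1 else 0 := rfl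
    rw [pow_succ, Matrix.mul_apply]
    simp only [ih, h, mul_ite, mul_one, mul_zero, Finset.sum_ite_eq', Finset.mem_univ, if_true]
    push_cast
    simp only [add_assoc, add_comm (1 : ZMod d)]

lemma pauli_apply (a b x y : ZMod d) :
    pauli (a, b) x y = if x = y + a then ZMod.stdAddChar (b * y) else 0 := by
  have h : (omega d ^ y.val) ^ b.val = ZMod.stdAddChar (b * y) := by
    rw [omega_pow_val, ← AddChar.map_nsmul_eq_pow, nsmul_eq_mul, ZMod.natCast_zmod_val]
  rw [pauli, clockZ, Matrix.diagonal_pow, Matrix.mul_diagonal, shiftX_pow_apply, Pi.pow_apply, h,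
    ZMod.natCast_zmod_val]
  simp

lemma star_stdAddChar (x : ZMod d) :
    star (ZMod.stdAddChar x : ℂ) = ZMod.stdAddChar (-x) := by
  rw [ZMod.stdAddChar_apply, ZMod.stdAddChar_apply, AddChar.map_neg_eq_inv,
    Circle.coe_inv_eq_conj]
  rfl

/-- The inverse of `X^a Z^b` is again of the form `ω^c X^a' Z^b'`. -/
def adjLabel (ab : ZMod d × ZMod d) : PauliLabel d := ⟨ab.1 * ab.2, -ab.1, -ab.2⟩

lemma toMatrix_adjLabel (ab : ZMod d × ZMod d) : (adjLabel ab).toMatrix = (pauli ab)ᴴ := by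
  obtain ⟨a, b⟩ := ab
  ext x y
  rw [Matrix.conjTranspose_apply, pauli_apply, PauliLabel.toMatrix, Matrix.smul_apply]
  simp only [adjLabel, pauli_apply, omega_pow_val, smul_eq_mul]
  by_cases h : y = x + a
  · subst h
    rw [if_pos (by ring), if_pos rfl, star_stdAddChar, ← AddChar.map_add_eq_mul]
    congr 1
    ring
  · rw [if_neg h, if_neg fun h' => h (by rw [h']; ring)]
    simp

lemma pauli_mul_conjTranspose (ab : ZMod d × ZMod d) : pauli ab * (pauli ab)ᴴ = 1 := by
  obtain ⟨a, b⟩ := ab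
  ext x y
  rw [Matrix.mul_apply, Finset.sum_eq_single (x - a)]
  · rw [Matrix.conjTranspose_apply, pauli_apply, pauli_apply, if_pos (by ring), Matrix.one_apply]
    by_cases h : x = y
    · subst h
      rw [if_pos (by ring), if_pos rfl, star_stdAddChar, ← AddChar.map_add_eq_mul]
      simp
    · rw [if_neg fun h' => h (by rw [h']; ring), if_neg h]
      simp
  · intro u _ hu
    rw [pauli_apply, if_neg fun h => hu (by rw [h]; ring), zero_mul]
  · simp

/-- The generalized Paulis form an orthogonal basis, so that averaging over them is
completely depolarizing. -/
lemma sum_pauli_mul_star (x y u v : ZMod d) :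
    ∑ ab : ZMod d × ZMod d, pauli ab x u * star (pauli ab y v) =
      if u = v ∧ x = y then (d : ℂ) else 0 := by
  have h (a b : ZMod d) : pauli (a, b) x u * star (pauli (a, b) y v) =
      if a = x - u then
        (if x - u = y - v then ZMod.stdAddChar (b * (u - v)) else 0) else 0 := by
    rw [pauli_apply, pauli_apply]
    by_cases hx : a = x - u
    · subst hx
      rw [if_pos (by ring), if_pos rfl]
      by_cases hy : x - u = y - v
      · rw [if_pos (by rw [hy]; ring), if_pos hy, star_stdAddChar, ← AddChar.map_add_eq_mul]
        congr 1
        ring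
      · rw [if_neg fun h' => hy (by rw [h']; ring), if_neg hy]
        simp
    · rw [if_neg fun h' => hx (by rw [h']; ring), if_neg hx, zero_mul]
  rw [Fintype.sum_prod_type_right]
  simp only [h, Finset.sum_ite_eq', Finset.mem_univ, if_true]
  by_cases hy : x - u = y - v
  · simp only [if_pos hy]
    rw [AddChar.sum_mulShift _ (ZMod.isPrimitive_stdAddChar d), ZMod.card]
    by_cases huv : u = v
    · subst huv
      rw [if_pos (sub_self _), if_pos ⟨rfl, by simpa using hy⟩]
    · rw [if_neg (sub_ne_zero.2 huv), if_neg fun h' => huv h'.1, Nat.cast_zero]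
  · simp only [if_neg hy, Finset.sum_const_zero]
    rw [if_neg]
    rintro ⟨rfl, rfl⟩
    exact hy rfl

end Pauli

/-! ### Tensor products and operators on some of the qudits -/

section Tensor

variable {d : ℕ}

lemma tensor_mul [NeZero d] {n : ℕ} (A B : Fin n → Matrix (ZMod d) (ZMod d) ℂ) :
    tensor A * tensor B = tensor fun i => A i * B i := by
  ext x y
  simp only [tensor, Matrix.mul_apply, Matrix.of_apply, ← Finset.prod_mul_distrib]
  exact (Fintype.prod_sum fun i u => A i (x i) u * B i u (y i)).symm

lemma tensor_one {n : ℕ} : tensor (fun _ : Fin n => (1 : Matrix (ZMod d) (ZMod d) ℂ)) = 1 := by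
  ext x y
  simp only [tensor, Matrix.of_apply, Matrix.one_apply, Finset.prod_ite_zero,
    Finset.prod_const_one, Finset.mem_univ, true_imp_iff, funext_iff]

lemma tensor_conjTranspose {n : ℕ} (A : Fin n → Matrix (ZMod d) (ZMod d) ℂ) :
    (tensor A)ᴴ = tensor fun i => (A i)ᴴ := by
  ext x y
  simp [tensor, Matrix.conjTranspose_apply]

/-- Averaging a traceless operator over the conjugations by products of Paulis gives zero. -/
lemma sum_pauli_conj_eq_zero [NeZero d] {k : ℕ} (A : QuditOp d k) (hA : A.trace = 0) :
    ∑ w : Fin k → ZMod d × ZMod d,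
      tensor (fun i => pauli (w i)) * A * (tensor fun i => pauli (w i))ᴴ = 0 := by
  ext x y
  have h (u v : Fin k → ZMod d) :
      ∑ w : Fin k → ZMod d × ZMod d,
        (∏ i, pauli (w i) (x i) (u i)) * A u v * star (∏ i, pauli (w i) (y i) (v i)) =
      if u = v then A u v * ∏ i, (if x i = y i then (d : ℂ) else 0) else 0 := by
    have h1 : ∑ w : Fin k → ZMod d × ZMod d,
        (∏ i, pauli (w i) (x i) (u i)) * A u v * star (∏ i, pauli (w i) (y i) (v i)) =
        A u v * ∏ i, ∑ ab, pauli ab (x i) (u i) * star (pauli ab (y i) (v i)) := by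
      rw [Fintype.prod_sum, Finset.mul_sum]
      refine Finset.sum_congr rfl fun w _ => ?_
      rw [Finset.prod_mul_distrib, star_prod]
      ring
    simp only [h1, sum_pauli_mul_star]
    by_cases huv : u = v
    · subst huv
      simp
    · obtain ⟨i, hi⟩ := Function.ne_iff.1 huv
      rw [if_neg huv, Finset.prod_eq_zero (Finset.mem_univ i) (if_neg fun h' => hi h'.1), mul_zero]
  simp only [Matrix.sum_apply, Matrix.mul_apply, Matrix.conjTranspose_apply, tensor,
    Matrix.of_apply, Finset.sum_mul, Matrix.zero_apply]
  rw [Finset.sum_comm]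
  simp_rw [Finset.sum_comm (s := (Finset.univ : Finset (Fin k → ZMod d × ZMod d)))]
  simp only [h, Finset.sum_ite_eq', Finset.mem_univ, if_true]
  rw [← Finset.sum_mul]
  have : ∑ u, A u u = 0 := hA
  rw [this, zero_mul]

variable {n k : ℕ}

open Classical in
/-- The bipartition of the qudits into those chosen by `c` and the others. -/
noncomputable def splitIndex (d : ℕ) (c : Fin k ↪o Fin n) :
    (Fin n → ZMod d) ≃ (Fin k → ZMod d) × ({i // i ∉ Set.range c} → ZMod d) :=
  (Equiv.arrowCongr (((Equiv.ofInjective c c.injective).sumCongr (Equiv.refl _)).trans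
    (Equiv.Set.sumCompl (Set.range c))).symm (Equiv.refl _)).trans
      (Equiv.sumArrowEquivProdArrow _ _ _)

lemma splitIndex_apply (c : Fin k ↪o Fin n) (x : Fin n → ZMod d) :
    splitIndex d c x = (fun l => x (c l), fun i => x i.1) := rfl

open Classical in
lemma actOn_eq_submatrix (c : Fin k ↪o Fin n) (A : QuditOp d k) :
    actOn c A = (A ⊗ₖ (1 : Matrix ({i // i ∉ Set.range c} → ZMod d) _ ℂ)).submatrix
      (splitIndex d c) (splitIndex d c) := by
  ext x y
  simp [actOn, splitIndex_apply, Matrix.one_apply, funext_iff, Matrix.kroneckerMap_apply]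

open Classical in
lemma tensor_eq_submatrix (c : Fin k ↪o Fin n) (Q : Fin n → Matrix (ZMod d) (ZMod d) ℂ) :
    tensor Q = (tensor (fun l => Q (c l)) ⊗ₖ
      Matrix.of fun x y : {i // i ∉ Set.range c} → ZMod d => ∏ i, Q i.1 (x i) (y i)).submatrix
      (splitIndex d c) (splitIndex d c) := by
  ext x y
  simp only [tensor, Matrix.of_apply, Matrix.submatrix_apply, splitIndex_apply,
    Matrix.kroneckerMap_apply]
  rw [← (((Equiv.ofInjective c c.injective).sumCongr (Equiv.refl _)).trans
    (Equiv.Set.sumCompl (Set.range c))).prod_comp, Fintype.prod_sum_type]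
  rfl

/-- Conjugation of a local operator by a product unitary only involves the factors on the
qudits where the operator acts. -/
lemma tensor_mul_actOn_mul [NeZero d] (c : Fin k ↪o Fin n)
    (Q : Fin n → Matrix (ZMod d) (ZMod d) ℂ) (hQ : ∀ i, Q i * (Q i)ᴴ = 1) (A : QuditOp d k) :
    tensor Q * actOn c A * (tensor Q)ᴴ =
      actOn c (tensor (fun l => Q (c l)) * A * (tensor fun l => Q (c l))ᴴ) := by
  classical
  rw [tensor_eq_submatrix c, actOn_eq_submatrix, actOn_eq_submatrix, Matrix.conjTranspose_submatrix,
    Matrix.submatrix_mul_equiv, Matrix.submatrix_mul_equiv, Matrix.conjTranspose_kronecker,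
    ← Matrix.mul_kronecker_mul, ← Matrix.mul_kronecker_mul, Matrix.mul_one]
  congr 2
  ext x y
  simp only [Matrix.mul_apply, Matrix.of_apply, Matrix.conjTranspose_apply, star_prod,
    ← Finset.prod_mul_distrib]
  have h (i : Fin n) (a b : ZMod d) : ∑ u, Q i a u * star (Q i b u) = if a = b then 1 else 0 := by
    rw [← Matrix.one_apply, ← hQ i, Matrix.mul_apply]
    rfl
  rw [← Fintype.prod_sum fun (i : {i // i ∉ Set.range c}) u => Q i.1 (x i) u * star (Q i.1 (y i) u)]
  simp only [h, Matrix.one_apply, Finset.prod_ite_zero, Finset.prod_const_one, Finset.mem_univ,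
    true_imp_iff, funext_iff]

lemma actOn_sum {ι : Type*} (s : Finset ι) (c : Fin k ↪o Fin n) (A : ι → QuditOp d k) :
    actOn c (∑ j ∈ s, A j) = ∑ j ∈ s, actOn c (A j) := by
  ext x y
  simp only [actOn, Matrix.of_apply, Matrix.sum_apply]
  split_ifs <;> simp

lemma actOn_zero (c : Fin k ↪o Fin n) : actOn c (0 : QuditOp d k) = 0 := by
  simpa using actOn_sum (d := d) ∅ c (fun _ : Empty => 0)

lemma actOn_isHermitian (c : Fin k ↪o Fin n) {A : QuditOp d k} (hA : A.IsHermitian) :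
    (actOn c A).IsHermitian := by
  ext x y
  have : ∀ u v, star (A u v) = A v u := fun u v => hA.apply v u
  simp only [actOn, Matrix.of_apply, Matrix.conjTranspose_apply, apply_ite star, star_zero, this]
  simp only [eq_comm]

end Tensor

/-! ### Decoupling by an orthogonal array -/

section Decoupling

variable {d n k N : ℕ} [NeZero d]

lemma IsLocalHamiltonian.isHermitian {H : QuditOp d n} (hH : IsLocalHamiltonian k H) :
    H.IsHermitian := by
  obtain ⟨h, hh, rfl⟩ := hH
  rw [Matrix.IsHermitian, Matrix.conjTranspose_sum]
  exact Finset.sum_congr rfl fun c _ => actOn_isHermitian c (hh c).1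

lemma rowOp_mul_conjTranspose (P : Fin (d ^ 2) ≃ ZMod d × ZMod d)
    (M : Matrix (Fin N) (Fin n) (Fin (d ^ 2))) (j : Fin N) :
    rowOp P M j * (rowOp P M j)ᴴ = 1 := by
  simp only [rowOp, tensor_conjTranspose, tensor_mul, pauli_mul_conjTranspose, tensor_one]

/-- On any `k` columns the rows run through all tuples of Paulis equally often, so the sum over
the rows is a multiple of the sum over all tuples. -/
lemma sum_rowOp_conj_eq_zero (P : Fin (d ^ 2) ≃ ZMod d × ZMod d)
    {M : Matrix (Fin N) (Fin n) (Fin (d ^ 2))} (hM : IsOrthogonalArray M k) {H : QuditOp d n}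
    (hH : IsLocalHamiltonian k H) :
    ∑ j, rowOp P M j * H * (rowOp P M j)ᴴ = 0 := by
  classical
  obtain ⟨h, hh, rfl⟩ := hH
  simp only [Finset.mul_sum, Finset.sum_mul]
  rw [Finset.sum_comm]
  refine Finset.sum_eq_zero fun c _ => ?_
  simp only [rowOp, tensor_mul_actOn_mul c _ fun i => pauli_mul_conjTranspose _]
  rw [← actOn_sum]
  suffices hs : ∑ j, tensor (fun l => pauli (P (M j (c l)))) * h c *
      (tensor fun l => pauli (P (M j (c l))))ᴴ = 0 by rw [hs, actOn_zero]
  set F : (Fin k → Fin (d ^ 2)) → QuditOp d k := fun w =>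
    tensor (fun l => pauli (P (w l))) * h c * (tensor fun l => pauli (P (w l)))ᴴ
  have hsum : ∑ w, F w = 0 := by
    rw [← sum_pauli_conj_eq_zero (h c) (hh c).2]
    exact (Equiv.arrowCongr (Equiv.refl (Fin k)) P).sum_comp fun w =>
      tensor (fun i => pauli (w i)) * h c * (tensor fun i => pauli (w i))ᴴ
  have hd : (d ^ 2) ^ k ≠ 0 := pow_ne_zero _ (pow_ne_zero _ (NeZero.ne d))
  have hfib : ∑ j, F (fun l => M j (c l)) =
      ∑ w, (Finset.univ.filter fun j => ∀ i, M j (c i) = w i).card • F w := by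
    rw [← Finset.sum_fiberwise (s := Finset.univ) (g := fun j l => M j (c l))]
    refine Finset.sum_congr rfl fun w _ => ?_
    rw [← Finset.sum_const]
    refine Finset.sum_congr (by simp only [funext_iff]) fun j hj => ?_
    congr 1
    ext1 l
    simpa using congrArg (· l) (by simpa [funext_iff] using hj : (fun l => M j (c l)) = w)
  change ∑ j, F (fun l => M j (c l)) = 0
  have h0 : ((d ^ 2) ^ k) • ∑ j, F (fun l => M j (c l)) = 0 := by
    rw [hfib, Finset.smul_sum]
    simp only [smul_smul, mul_comm ((d ^ 2) ^ k), hM.2 c]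
    rw [← Finset.smul_sum, hsum, smul_zero]
  rw [← Nat.cast_smul_eq_nsmul ℂ] at h0
  exact (smul_eq_zero.1 h0).resolve_left (Nat.cast_ne_zero.2 hd)

end Decoupling

/-! ### Block-diagonal operators and time evolutions -/

section Block

variable {ι : Type*} [Fintype ι] [DecidableEq ι]

/-- The block-diagonal operator `|0⟩⟨0| ⊗ A + |1⟩⟨1| ⊗ B`, as a `⋆`-homomorphism in `(A, B)`. -/
noncomputable def block : Matrix ι ι ℂ × Matrix ι ι ℂ →⋆ₐ[ℂ] Matrix (Fin 2 × ι) (Fin 2 × ι) ℂ where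
  toFun p := Matrix.single (0 : Fin 2) (0 : Fin 2) (1 : ℂ) ⊗ₖ p.1 +
    Matrix.single (1 : Fin 2) (1 : Fin 2) (1 : ℂ) ⊗ₖ p.2
  map_one' := by
    ext ⟨a, x⟩ ⟨b, y⟩
    fin_cases a <;> fin_cases b <;> simp [Matrix.one_apply]
  map_mul' p q := by
    simp [add_mul, mul_add, ← Matrix.mul_kronecker_mul]
  map_zero' := by simp
  map_add' p q := by
    simp only [Prod.fst_add, Prod.snd_add, Matrix.kronecker_add]
    abel
  commutes' c := by
    ext ⟨a, x⟩ ⟨b, y⟩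
    fin_cases a <;> fin_cases b <;> simp [Matrix.algebraMap_matrix_apply]
  map_star' p := by
    simp [Matrix.star_eq_conjTranspose, Matrix.conjTranspose_kronecker]

lemma one_kronecker_eq_block (A : Matrix ι ι ℂ) :
    (1 : Matrix (Fin 2) (Fin 2) ℂ) ⊗ₖ A = block (A, A) := by
  ext ⟨a, x⟩ ⟨b, y⟩
  fin_cases a <;> fin_cases b <;> simp [block]

lemma Lam_eq_block {d n : ℕ} [NeZero d] (V : QuditOp d n) : Lam V = block (V, 1) := rfl

lemma ctrl_eq_block {d n : ℕ} [NeZero d] (V : QuditOp d n) : ctrl V = block (1, V) := rfl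

lemma continuous_block : Continuous (block (ι := ι)) :=
  LinearMap.continuous_of_finiteDimensional (block (ι := ι)).toAlgHom.toLinearMap

lemma evolution_block (A B : Matrix ι ι ℂ) (t : ℝ) :
    evolution (block (A, B)) t = block (evolution A t, evolution B t) := by
  let : NormedAlgebra ℚ (Matrix ι ι ℂ) := NormedAlgebra.restrictScalars ℚ ℂ _
  let : NormedAlgebra ℚ (Matrix (Fin 2 × ι) (Fin 2 × ι) ℂ) := NormedAlgebra.restrictScalars ℚ ℂ _
  have h := NormedSpace.map_exp block continuous_block
    ((-Complex.I * (t : ℂ)) • ((A, B) : Matrix ι ι ℂ × Matrix ι ι ℂ))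
  rw [evolution, ← map_smul, ← h]
  congr 1
  exact Prod.ext (Prod.fst_exp _) (Prod.snd_exp _)

lemma evolution_zero (t : ℝ) : evolution (0 : Matrix ι ι ℂ) t = 1 := by
  rw [evolution, smul_zero, NormedSpace.exp_zero]

lemma evolution_mem_unitary {K : Matrix ι ι ℂ} (hK : K.IsHermitian) (t : ℝ) :
    evolution K t ∈ Matrix.unitaryGroup ι ℂ := by
  let : NormedAlgebra ℚ (Matrix ι ι ℂ) := NormedAlgebra.restrictScalars ℚ ℂ _
  refine NormedSpace.exp_mem_unitary_of_mem_skewAdjoint ?_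
  have h : star K = K := hK
  rw [skewAdjoint.mem_iff, star_smul, h, ← neg_smul]
  simp

lemma evolution_pow (K : Matrix ι ι ℂ) (t : ℝ) (r : ℕ) :
    evolution K t ^ r = evolution K (r * t) := by
  let : NormedAlgebra ℚ (Matrix ι ι ℂ) := NormedAlgebra.restrictScalars ℚ ℂ _
  rw [evolution, evolution, ← NormedSpace.exp_nsmul, ← Nat.cast_smul_eq_nsmul ℂ, smul_smul]
  push_cast
  ring_nf

lemma evolution_smul (K : Matrix ι ι ℂ) (s t : ℝ) :
    evolution ((s : ℂ) • K) t = evolution K (s * t) := by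
  rw [evolution, evolution, smul_smul]
  push_cast
  ring_nf

lemma evolution_conj (K : Matrix ι ι ℂ) (t : ℝ) {V : Matrix ι ι ℂ} (hV : V * Vᴴ = 1) :
    evolution (V * K * Vᴴ) t = V * evolution K t * Vᴴ := by
  have hinv : V⁻¹ = Vᴴ := Matrix.inv_eq_right_inv hV
  have hu : IsUnit V := ⟨⟨V, Vᴴ, hV, mul_eq_one_comm.1 hV⟩, rfl⟩
  rw [evolution, evolution, ← hinv, ← Matrix.exp_conj V _ hu, Matrix.mul_smul, Matrix.smul_mul]

end Block

/-! ### The controlization circuit -/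

section Circuit

variable {d n N : ℕ} [NeZero d]

lemma Circuit.toOp_append (H : QuditOp d n) (c c' : Circuit d n) :
    Circuit.toOp H (c ++ c') = Circuit.toOp H c' * Circuit.toOp H c := by
  induction c with
  | nil => simp [Circuit.toOp]
  | cons g c ih => simp only [List.cons_append, Circuit.toOp, ih, mul_assoc]

lemma Circuit.toOp_flatten (H : QuditOp d n) (L : List (Circuit d n)) :
    Circuit.toOp H L.flatten = (L.map (Circuit.toOp H)).reverse.prod := by
  induction L with
  | nil => simp [Circuit.toOp]
  | cons c L ih => simp [Circuit.toOp_append, ih]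

omit [NeZero d] in
lemma Circuit.numCtrlPaulis_append (c c' : Circuit d n) :
    Circuit.numCtrlPaulis (c ++ c') = c.numCtrlPaulis + c'.numCtrlPaulis := by
  induction c with
  | nil => simp [Circuit.numCtrlPaulis]
  | cons g c ih =>
    cases g <;> simp only [List.cons_append, Circuit.numCtrlPaulis, ih]
    ring

omit [NeZero d] in
lemma Circuit.numCtrlPaulis_flatten (L : List (Circuit d n)) :
    Circuit.numCtrlPaulis L.flatten = (L.map Circuit.numCtrlPaulis).sum := by
  induction L with
  | nil => simp [Circuit.numCtrlPaulis]
  | cons c L ih => simp [Circuit.numCtrlPaulis_append, ih]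

variable (P : Fin (d ^ 2) ≃ ZMod d × ZMod d) (M : Matrix (Fin N) (Fin n) (Fin (d ^ 2)))

/-- The black box for the time `τ`, conjugated by `Λ(U_j)`. As the first gate of the list is
applied first, it is the one that realizes `Λ(U_j)†`. -/
def conjCircuit (τ : ℝ≥0) (j : Fin N) : Circuit d n :=
  [.ctrlPauli fun i => adjLabel (P (M j i)), .blackBox τ,
    .ctrlPauli fun i => ⟨0, (P (M j i)).1, (P (M j i)).2⟩]

lemma Lam_rowOp_mul_conjTranspose (j : Fin N) : Lam (rowOp P M j) * (Lam (rowOp P M j))ᴴ = 1 := by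
  rw [Lam_eq_block, ← Matrix.star_eq_conjTranspose, ← map_star, ← map_mul, Prod.star_def,
    Prod.mk_mul_mk, Matrix.star_eq_conjTranspose, rowOp_mul_conjTranspose, star_one, mul_one]
  exact map_one block

lemma toOp_conjCircuit (H : QuditOp d n) (τ : ℝ≥0) (j : Fin N) :
    (conjCircuit P M τ j).toOp H =
      Lam (rowOp P M j) * ((1 : Matrix (Fin 2) (Fin 2) ℂ) ⊗ₖ evolution H τ) *
        (Lam (rowOp P M j))ᴴ := by
  have h1 : tensor (fun i => (⟨0, (P (M j i)).1, (P (M j i)).2⟩ : PauliLabel d).toMatrix) =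
      rowOp P M j := by
    simp [PauliLabel.toMatrix, rowOp]
  have h2 : Lam (tensor fun i => (adjLabel (P (M j i))).toMatrix) = (Lam (rowOp P M j))ᴴ := by
    rw [Lam_eq_block, Lam_eq_block, ← Matrix.star_eq_conjTranspose, ← map_star, Prod.star_def,
      star_one, Matrix.star_eq_conjTranspose, rowOp, tensor_conjTranspose]
    simp only [toMatrix_adjLabel]
  simp only [conjCircuit, Circuit.toOp, Gate.toOp, h1, h2, one_mul]

/-- The conjugated black box is the evolution under one term of the scheme. -/
lemma toOp_conjCircuit_eq_evolution (H : QuditOp d n) {τ : ℝ≥0} {s : ℝ} (hτ : (τ : ℝ) = 1 / N * s)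
    (j : Fin N) : (conjCircuit P M τ j).toOp H = evolution (schemeTerm P M H j) s := by
  have hN : (1 / (N : ℂ)) = ((1 / N : ℝ) : ℂ) := by push_cast; rfl
  rw [toOp_conjCircuit, schemeTerm, hN, evolution_smul, ← hτ,
    evolution_conj _ _ (Lam_rowOp_mul_conjTranspose P M j), one_kronecker_eq_block,
    one_kronecker_eq_block, evolution_block]

/-- The circuit for the second-order product formula with `r` steps. -/
def trotterCircuit (τ : ℝ≥0) (r : ℕ) : Circuit d n :=
  (List.replicate r ((List.ofFn (conjCircuit P M τ)).flatten ++
    (List.ofFn (conjCircuit P M τ)).reverse.flatten)).flatten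

lemma toOp_trotterCircuit (H : QuditOp d n) {τ : ℝ≥0} {t : ℝ} {r : ℕ}
    (hτ : (τ : ℝ) = 1 / N * (t / (2 * r))) :
    (trotterCircuit P M τ r).toOp H = trotter2 (schemeTerm P M H) t r := by
  have h : Circuit.toOp H ∘ conjCircuit P M τ =
      fun j => evolution (schemeTerm P M H j) (t / (2 * r)) :=
    funext fun j => toOp_conjCircuit_eq_evolution P M H hτ j
  rw [trotterCircuit, Circuit.toOp_flatten, List.map_replicate, List.reverse_replicate,
    List.prod_replicate, Circuit.toOp_append, Circuit.toOp_flatten, Circuit.toOp_flatten,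
    List.map_reverse, List.reverse_reverse, List.map_ofFn, h]
  rfl

omit [NeZero d] in
lemma numCtrlPaulis_trotterCircuit (τ : ℝ≥0) (r : ℕ) :
    (trotterCircuit P M τ r).numCtrlPaulis = r * (4 * N) := by
  have h : Circuit.numCtrlPaulis ∘ conjCircuit P M τ = fun _ => 2 := rfl
  rw [trotterCircuit, Circuit.numCtrlPaulis_flatten, List.map_replicate, List.sum_replicate,
    Circuit.numCtrlPaulis_append, Circuit.numCtrlPaulis_flatten, Circuit.numCtrlPaulis_flatten,
    List.map_reverse, List.sum_reverse, List.map_ofFn, h, List.sum_ofFn]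
  simp
  left
  ring

end Circuit

/-! ### Properties of the scheme -/

section Scheme

variable {d n k N : ℕ} [NeZero d] (P : Fin (d ^ 2) ≃ ZMod d × ZMod d)
  (M : Matrix (Fin N) (Fin n) (Fin (d ^ 2)))

lemma schemeTerm_eq_block (H : QuditOp d n) (j : Fin N) :
    schemeTerm P M H j = (1 / (N : ℂ)) • block (rowOp P M j * H * (rowOp P M j)ᴴ, H) := by
  rw [schemeTerm, Lam_eq_block, one_kronecker_eq_block, ← Matrix.star_eq_conjTranspose,
    ← map_star, ← map_mul, ← map_mul, Prod.star_def, Prod.mk_mul_mk, Prod.mk_mul_mk, star_one,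
    one_mul, mul_one, Matrix.star_eq_conjTranspose]

lemma schemeTerm_isHermitian {H : QuditOp d n} (hH : H.IsHermitian) (j : Fin N) :
    (schemeTerm P M H j).IsHermitian := by
  have h : star (rowOp P M j * H * (rowOp P M j)ᴴ, H) = (rowOp P M j * H * (rowOp P M j)ᴴ, H) :=
    Prod.ext (Matrix.isHermitian_mul_mul_conjTranspose _ hH) hH
  rw [schemeTerm_eq_block, Matrix.IsHermitian, Matrix.conjTranspose_smul,
    ← Matrix.star_eq_conjTranspose, ← map_star, h]
  simp

lemma norm_le_one_of_mem_unitary {V : CtrlOp d n}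
    (hV : V ∈ Matrix.unitaryGroup (Fin 2 × (Fin n → ZMod d)) ℂ) : ‖V‖ ≤ 1 :=
  (CStarRing.norm_of_mem_unitary hV).le

lemma norm_schemeTerm_le (H : QuditOp d n) (j : Fin N) : ‖schemeTerm P M H j‖ ≤ ‖H‖ / N := by
  have hV : ‖Lam (rowOp P M j)‖ ≤ 1 := norm_le_one_of_mem_unitary <|
    Matrix.mem_unitaryGroup_iff.2 (Lam_rowOp_mul_conjTranspose P M j)
  have hH : ‖(1 : Matrix (Fin 2) (Fin 2) ℂ) ⊗ₖ H‖ ≤ ‖H‖ := by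
    rw [one_kronecker_eq_block]
    refine (NonUnitalStarAlgHom.norm_apply_le block (H, H)).trans ?_
    simp [Prod.norm_def]
  rw [schemeTerm, norm_smul, norm_div, norm_one, Complex.norm_natCast, div_eq_inv_mul,
    div_eq_inv_mul, mul_one]
  refine mul_le_mul_of_nonneg_left ?_ (by positivity)
  calc _ ≤ ‖Lam (rowOp P M j)‖ * ‖(1 : Matrix (Fin 2) (Fin 2) ℂ) ⊗ₖ H‖ *
        ‖(Lam (rowOp P M j))ᴴ‖ :=
        (norm_mul_le _ _).trans (mul_le_mul_of_nonneg_right (norm_mul_le _ _) (norm_nonneg _))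
    _ ≤ 1 * ‖H‖ * 1 := by
        rw [Matrix.l2_opNorm_conjTranspose]
        gcongr
    _ = ‖H‖ := by ring

variable {M}

/-- Only the block in which the control qubit is `|1⟩` survives in the sum of the terms. -/
lemma sum_schemeTerm (hM : IsOrthogonalArray M k) {H : QuditOp d n}
    (hH : IsLocalHamiltonian k H) : ∑ j, schemeTerm P M H j = block (0, H) := by
  have hN : (N : ℂ) ≠ 0 := Nat.cast_ne_zero.2 hM.1.ne'
  simp only [schemeTerm_eq_block]
  rw [← Finset.smul_sum, ← map_sum, ← map_smul]
  congr 1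
  refine Prod.ext ?_ ?_
  · simp [Prod.fst_sum, sum_rowOp_conj_eq_zero P hM hH]
  · simp only [Prod.smul_snd, Prod.snd_sum, Finset.sum_const, Finset.card_univ, Fintype.card_fin]
    rw [← Nat.cast_smul_eq_nsmul ℂ, smul_smul, one_div_mul_cancel hN, one_smul]

lemma evolution_sum_schemeTerm (hM : IsOrthogonalArray M k) {H : QuditOp d n}
    (hH : IsLocalHamiltonian k H) (t : ℝ) :
    evolution (∑ j, schemeTerm P M H j) t = ctrl (evolution H t) := by
  rw [sum_schemeTerm P hM hH, evolution_block, evolution_zero, ctrl_eq_block]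

end Scheme

/-! ### The error of the product formula -/

section Error

variable {d n N : ℕ} [NeZero d]

lemma trotter2_mem_unitary {K : Fin N → CtrlOp d n} (hK : ∀ j, (K j).IsHermitian) (t : ℝ) (r : ℕ) :
    trotter2 K t r ∈ Matrix.unitaryGroup (Fin 2 × (Fin n → ZMod d)) ℂ := by
  have h : ∀ V ∈ List.ofFn fun j => evolution (K j) (t / (2 * r)),
      V ∈ Matrix.unitaryGroup (Fin 2 × (Fin n → ZMod d)) ℂ := by
    intro V hV
    obtain ⟨j, rfl⟩ := List.mem_ofFn.1 hV
    exact evolution_mem_unitary (hK j) _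
  exact pow_mem (mul_mem (Submonoid.list_prod_mem _ h)
    (Submonoid.list_prod_mem _ fun V hV => h V (List.mem_reverse.1 hV))) r

/-- The errors of the `r` steps add up, because both a step and the exact evolution are unitary.
For long steps the Taylor estimate is replaced by the trivial bound `2`. -/
lemma norm_trotter2_sub_evolution_le {K : Fin N → CtrlOp d n} (hK : ∀ j, (K j).IsHermitian)
    {h t : ℝ} (ht : 0 ≤ t) (hKn : ∀ j, ‖K j‖ ≤ h / N) {r : ℕ} (hr : 0 < r) (hN : 0 < N) :
    ‖trotter2 K t r - evolution (∑ j, K j) t‖ ≤ 2 * (t * h) ^ 3 / r ^ 2 := by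
  have hr' : (r : ℝ) ≠ 0 := Nat.cast_ne_zero.2 hr.ne'
  have hrC : (r : ℂ) ≠ 0 := Nat.cast_ne_zero.2 hr.ne'
  have hN' : (N : ℝ) ≠ 0 := Nat.cast_ne_zero.2 hN.ne'
  set S := (List.ofFn fun j => evolution (K j) (t / (2 * r))).prod *
    (List.ofFn fun j => evolution (K j) (t / (2 * r))).reverse.prod with hS
  set E := evolution (∑ j, K j) (t / r) with hE
  have hSu : ‖S‖ ≤ 1 := by
    have := trotter2_mem_unitary hK (t / r) 1
    rw [trotter2, pow_one, Nat.cast_one, mul_one, div_div, mul_comm (r : ℝ)] at this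
    exact norm_le_one_of_mem_unitary this
  have hEu : ‖E‖ ≤ 1 := by
    refine norm_le_one_of_mem_unitary (evolution_mem_unitary ?_ _)
    rw [Matrix.IsHermitian, Matrix.conjTranspose_sum]
    exact Finset.sum_congr rfl fun j _ => hK j
  have hstep : ‖S - E‖ ≤ 2 * (t * h / r) ^ 3 := by
    rcases le_total (t * h / r) 1 with hx | hx
    · set L := List.ofFn fun j => (-Complex.I * ((t / (2 * r) : ℝ) : ℂ)) • K j with hL
      have hmap : L.map NormedSpace.exp = List.ofFn fun j => evolution (K j) (t / (2 * r)) := by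
        rw [hL, List.map_ofFn]
        rfl
      have hsum : NormedSpace.exp ((2 : ℂ) • L.sum) = E := by
        rw [hL, List.sum_ofFn, ← Finset.smul_sum, smul_smul, hE, evolution]
        congr 2
        push_cast
        field_simp
      have hnorm : 2 * (L.map norm).sum ≤ t * h / r := by
        rw [hL, List.map_ofFn, List.sum_ofFn]
        have : ∀ j, (norm ∘ fun j => (-Complex.I * ((t / (2 * r) : ℝ) : ℂ)) • K j) j ≤
            t / (2 * r) * (h / N) := by
          intro j
          rw [Function.comp_apply, norm_smul, norm_mul, norm_neg, Complex.norm_I, one_mul,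
            Complex.norm_real, Real.norm_of_nonneg (by positivity)]
          exact mul_le_mul_of_nonneg_left (hKn j) (by positivity)
        calc _ ≤ 2 * ∑ _j : Fin N, t / (2 * r) * (h / N) :=
              mul_le_mul_of_nonneg_left (Finset.sum_le_sum fun j _ => this j) (by norm_num)
          _ = t * h / r := by
              rw [Finset.sum_const, Finset.card_univ, Fintype.card_fin, nsmul_eq_mul]
              field_simp
      have := norm_palindrome_sub_exp_le L hnorm hx
      rwa [hmap, hsum] at this
    · have h1 : ‖S - E‖ ≤ 2 := (norm_sub_le _ _).trans (by linarith)
      have h2 : 1 ≤ (t * h / r) ^ 3 := one_le_pow₀ hx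
      linarith
  have hpow : evolution (∑ j, K j) t = E ^ r := by
    rw [hE, evolution_pow]
    congr 1
    field_simp
  rw [trotter2, ← hS, hpow]
  calc _ ≤ r * ‖S - E‖ := norm_pow_sub_pow_le hSu hEu r
    _ ≤ r * (2 * (t * h / r) ^ 3) := mul_le_mul_of_nonneg_left hstep (by positivity)
    _ = _ := by field_simp

end Error

end Controlization

theorem mainTheorem3 :
    ∃ C : ℝ, 0 < C ∧
      ∀ (d n k N : ℕ) [NeZero d] (M : Matrix (Fin N) (Fin n) (Fin (d ^ 2)))
        (P : Fin (d ^ 2) ≃ ZMod d × ZMod d),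
        Controlization.IsOrthogonalArray M k →
        ∀ (t h ε : ℝ), 0 ≤ t → 0 ≤ h → 0 < ε →
          ∃ (r : ℕ) (c : Controlization.Circuit d n), 0 < r ∧
            (c.numCtrlPaulis : ℝ) ≤
              C * N * max 1 (t ^ (3 / 2 : ℝ) * h ^ (3 / 2 : ℝ) / ε ^ (1 / 2 : ℝ)) ∧
            ∀ H : Controlization.QuditOp d n,
              Controlization.IsLocalHamiltonian k H → ‖H‖ ≤ h →
                c.toOp H ∈ Matrix.unitaryGroup (Fin 2 × (Fin n → ZMod d)) ℂ ∧
                c.toOp H =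
                  Controlization.trotter2 (Controlization.schemeTerm P M H) t r ∧
                ‖c.toOp H - Controlization.ctrl (Controlization.evolution H t)‖ ≤ ε := by
  refine ⟨16, by norm_num, fun d n k N _ M P hM t h ε ht hh hε => ?_⟩
  set y : ℝ := t ^ (3 / 2 : ℝ) * h ^ (3 / 2 : ℝ) / ε ^ (1 / 2 : ℝ) with hy
  have hy0 : 0 ≤ y := by positivity
  have hsq {x : ℝ} (hx : 0 ≤ x) : (x ^ (3 / 2 : ℝ)) ^ 2 = x ^ 3 := by
    rw [← Real.rpow_natCast, ← Real.rpow_mul hx, ← Real.rpow_natCast]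
    norm_num
  have hy2 : y ^ 2 = (t * h) ^ 3 / ε := by
    rw [hy, div_pow, mul_pow, hsq ht, hsq hh, ← mul_pow, ← Real.rpow_natCast (ε ^ _),
      ← Real.rpow_mul hε.le]
    norm_num
  -- The error bound `2 (t h)³ / r²` equals `2 ε (y / r)²`, so `r ≥ 2 y` steps suffice.
  set r : ℕ := ⌈2 * y⌉₊ + 1 with hr
  have hr0 : 0 < r := Nat.succ_pos _
  have hry : 2 * y ≤ r := by
    rw [hr]
    push_cast
    linarith [Nat.le_ceil (2 * y)]
  have hrle : (r : ℝ) ≤ 4 * max 1 y := by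
    rw [hr]
    push_cast
    linarith [Nat.ceil_lt_add_one (mul_nonneg zero_le_two hy0), le_max_left 1 y, le_max_right 1 y]
  obtain ⟨τ, hτ⟩ : ∃ τ : ℝ≥0, (τ : ℝ) = 1 / N * (t / (2 * r)) :=
    ⟨Real.toNNReal _, Real.coe_toNNReal _ (by positivity)⟩
  refine ⟨r, Controlization.trotterCircuit P M τ r, hr0, ?_, fun H hH hHn => ?_⟩
  · rw [Controlization.numCtrlPaulis_trotterCircuit]
    push_cast
    calc (r : ℝ) * (4 * N) ≤ 4 * max 1 y * (4 * N) := by gcongr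
      _ = _ := by ring
  · have hK := Controlization.schemeTerm_isHermitian P M hH.isHermitian
    rw [Controlization.toOp_trotterCircuit P M H hτ]
    refine ⟨Controlization.trotter2_mem_unitary hK t r, rfl, ?_⟩
    rw [← Controlization.evolution_sum_schemeTerm P hM hH]
    refine (Controlization.norm_trotter2_sub_evolution_le hK ht (h := h) (fun j =>
      (Controlization.norm_schemeTerm_le P M H j).trans (by gcongr)) hr0 hM.1).trans ?_
    have hr' : (0 : ℝ) < r := Nat.cast_pos.2 hr0
    have h1 : (t * h) ^ 3 = ε * y ^ 2 := by
      rw [hy2]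
      field_simp
    have h2 : (2 * y) ^ 2 ≤ (r : ℝ) ^ 2 := by gcongr
    rw [h1, div_le_iff₀ (by positivity)]
    nlinarith [mul_le_mul_of_nonneg_left h2 hε.le, mul_nonneg hε.le (sq_nonneg y)]
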